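/- Let $K>0$ be rational. Call a metric $\rho$ on a group $G$ \emph{finitely generated} if there is a finite set $A\subseteq G$ with $1\in A$ and $A=A^{-1}$ such that for all $a,b\in G$ $$\rho(a,b)=\min\{\rho(a_1,b_1)+\dots+\rho(a_n,b_n) : n\in\mathbb N,\ a_i,b_i\in A,\ a=a_1\cdots a_n,\ b=b_1\cdots b_n\}$$ (in particular the minimum exists and $A$ generates $G$), and \emph{rational} if all its values are rational. A \emph{finitely generated rational metric bounded by $K$} is a metric of the form $d=\min\{K,\rho\}$ with $\rho$ a finitely generated rational metric. Let $\mathcal G_K$ be the category whose objects are pairs $(F,d_F)$ of a finite set $F$ (possibly empty) and a finitely generated rational metric $d_F$ bounded by $K$ on the free group $G_F$ with $F$ as its set of free generators; a morphism $(F,d_F)\to(H,d_H)$ is an isometric group homomorphism $\iota:G_F\to G_H$ with $\iota(f)\in H$ for every $f\in F$. Theorem. The category $\mathcal G_K$ is a Fraïssé class, that is: (1) $\mathcal G_K$ has only countably many objects up to isomorphism; (2) (joint embedding) for any two objects $X,Y$ there are an object $Z$ and morphisms $X\to Z$, $Y\to Z$; (3) (amalgamation) for any morphisms $\varphi_1:X\to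 Y_1$, $\varphi_2:X\to Y_2$ there are an object $Z$ and morphisms $\psi_1:Y_1\to Z$, $\psi_2:Y_2\to Z$ with $\psi_1\circ\varphi_1=\psi_2\circ\varphi_2$. Moreover, in (3) the amalgam can be chosen so that the free generators of $Z$ are exactly the images under $\psi_1$ and $\psi_2$ of the free generators of $Y_1$ and $Y_2$, and a generator of $Y_1$ and a generator of $Y_2$ have the same image only if they are the images under $\varphi_1$ and $\varphi_2$ of one generator of $X$. That is, if $Y_1=G_0*H_1$ and $Y_2=G_0*H_2$, where $G_0$ is the free group of $X$ and $H_i$ is freely generated by the generators of $Y_i$ not coming from $X$, then the group of $Z$ is $G_0*H_1*H_2$ and $\psi_1,\psi_2$ are the canonical embeddings. -/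

import Mathlib

open CategoryTheory

universe u v w

/-- The set of all sums `d(a₁,b₁) + ... + d(aₙ,bₙ)` with all `aᵢ, bᵢ ∈ A`, `a = a₁ ⋯ aₙ` and
`b = b₁ ⋯ bₙ`; the list `l` is `[(a₁,b₁), ..., (aₙ,bₙ)]`. (For a metric `d` and `1 ∈ A` the empty
list gives nothing beyond the list `[(1,1)]`.) -/
def decompositionSums {G : Type u} [Group G] (d : G → G → ℝ) (A : Set G) (a b : G) : Set ℝ :=
  {s | ∃ l : List (G × G), (∀ p ∈ l, p.1 ∈ A ∧ p.2 ∈ A) ∧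
    (l.map Prod.fst).prod = a ∧ (l.map Prod.snd).prod = b ∧
    s = (l.map fun p => d p.1 p.2).sum}

/-- The metric of `G` is finitely generated: there is a finite symmetric set `A` containing `1`
such that every distance `d(a,b)` is the minimum of the sums `d(a₁,b₁) + ... + d(aₙ,bₙ)` over the
simultaneous decompositions of `a` and `b` into elements of `A`. As the minimum is required to
exist for all `a, b`, the set `A` generates `G`. -/
def IsFinitelyGeneratedMetric {G : Type u} [Group G] (m : MetricSpace G) : Prop :=
  ∃ A : Set G, A.Finite ∧ 1 ∈ A ∧ A⁻¹ = A ∧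
    ∀ a b : G, IsLeast (decompositionSums m.dist A a b) (m.dist a b)

/-- All distances are rational numbers. -/
def IsRationalMetric {G : Type u} (m : MetricSpace G) : Prop :=
  ∀ a b : G, ∃ q : ℚ, m.dist a b = (q : ℝ)

/-- A finitely generated rational metric bounded by `K`: the minimum of the constant `K` and a
finitely generated rational metric. -/
def IsFinitelyGeneratedRationalMetricBoundedBy {G : Type u} [Group G] (K : ℚ)
    (m : MetricSpace G) : Prop :=
  ∃ ρ : MetricSpace G, IsFinitelyGeneratedMetric ρ ∧ IsRationalMetric ρ ∧
    ∀ a b : G, m.dist a b = min (K : ℝ) (ρ.dist a b)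

/-- The objects of the category `𝒢_K`: a finite set `gens` and a finitely generated rational
metric bounded by `K` on the free group with `gens` as its set of free generators. -/
structure MetricFreeGroup (K : ℚ) : Type (u + 1) where
  gens : Type u
  finite_gens : Finite gens
  metric : MetricSpace (FreeGroup gens)
  metric_spec : IsFinitelyGeneratedRationalMetricBoundedBy K metric

namespace MetricFreeGroup

variable {K : ℚ}

instance instMetricSpace (X : MetricFreeGroup.{u} K) : MetricSpace (FreeGroup X.gens) := X.metric

/-- The morphisms of `𝒢_K`: isometric group homomorphisms sending free generators to free
generators. -/
@[ext]
structure Hom (X Y : MetricFreeGroup.{u} K) : Type u where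
  toMonoidHom : FreeGroup X.gens →* FreeGroup Y.gens
  isometry : Isometry toMonoidHom
  map_gen : ∀ f : X.gens, ∃ h : Y.gens, toMonoidHom (FreeGroup.of f) = FreeGroup.of h

/-- The identity morphism. -/
def Hom.id (X : MetricFreeGroup.{u} K) : Hom X X where
  toMonoidHom := MonoidHom.id _
  isometry := isometry_id
  map_gen f := ⟨f, rfl⟩

/-- The composition of two morphisms. -/
def Hom.comp {X Y Z : MetricFreeGroup.{u} K} (φ : Hom X Y) (ψ : Hom Y Z) : Hom X Z where
  toMonoidHom := ψ.toMonoidHom.comp φ.toMonoidHom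
  isometry := ψ.isometry.comp φ.isometry
  map_gen f := by
    obtain ⟨h, hh⟩ := φ.map_gen f
    obtain ⟨k, hk⟩ := ψ.map_gen h
    exact ⟨k, by rw [MonoidHom.comp_apply, hh, hk]⟩

instance instCategory : Category.{u} (MetricFreeGroup.{u} K) where
  Hom := Hom
  id := Hom.id
  comp := Hom.comp

/-- A commutative square of `X ⟶ Y₁`, `X ⟶ Y₂`, `Y₁ ⟶ Z`, `Y₂ ⟶ Z` that is a free amalgam: the
free generators of `Z` are those coming from `Y₁` and those coming from `Y₂`, and the only
identifications are those of generators coming from `X`. So if `Y₁ = X ∗ H₁` and `Y₂ = X ∗ H₂`,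
where `Hᵢ` is freely generated by the generators of `Yᵢ` outside the image of `X`, then `Z` is as a
group the free product `X ∗ H₁ ∗ H₂`, and `ψ₁`, `ψ₂` are the canonical embeddings. -/
structure IsFreeAmalgam {X Y₁ Y₂ Z : MetricFreeGroup.{u} K} (φ₁ : X ⟶ Y₁) (φ₂ : X ⟶ Y₂)
    (ψ₁ : Y₁ ⟶ Z) (ψ₂ : Y₂ ⟶ Z) : Prop where
  comm : φ₁ ≫ ψ₁ = φ₂ ≫ ψ₂
  gens_covered : ∀ h : Z.gens,
    (∃ f : Y₁.gens, ψ₁.toMonoidHom (FreeGroup.of f) = FreeGroup.of h) ∨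
    (∃ f : Y₂.gens, ψ₂.toMonoidHom (FreeGroup.of f) = FreeGroup.of h)
  gens_inter : ∀ (f₁ : Y₁.gens) (f₂ : Y₂.gens),
    ψ₁.toMonoidHom (FreeGroup.of f₁) = ψ₂.toMonoidHom (FreeGroup.of f₂) →
    ∃ f : X.gens, φ₁.toMonoidHom (FreeGroup.of f) = FreeGroup.of f₁ ∧
      φ₂.toMonoidHom (FreeGroup.of f) = FreeGroup.of f₂

end MetricFreeGroup

/-- A category of structures and chosen embeddings is a Fraïssé class if it has countably many
objects up to isomorphism, the joint embedding property and the amalgamation property. -/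
structure IsFraisseClass (C : Type v) [Category.{w} C] : Prop where
  countable : Countable (Quotient (isIsomorphicSetoid C))
  jointEmbedding : ∀ X Y : C, ∃ Z : C, Nonempty (X ⟶ Z) ∧ Nonempty (Y ⟶ Z)
  amalgamation : ∀ (X Y₁ Y₂ : C) (φ₁ : X ⟶ Y₁) (φ₂ : X ⟶ Y₂),
    ∃ (Z : C) (ψ₁ : Y₁ ⟶ Z) (ψ₂ : Y₂ ⟶ Z), φ₁ ≫ ψ₁ = φ₂ ≫ ψ₂

/-! ### Isometric actions whose displacements are controlled by a bi-invariant distance -/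

/-! The point is amalgamation. Let `m₁`, `m₂` be the truncated metrics of two groups `G₁`, `G₂` that
agree on `G₀`, and let `Γ` be the amalgamated product. Prescribe on `Γ` the finitely many distances
of `mᵢ` on the generating sets `Aᵢ`, and let `ρ` be the least sum over simultaneous decompositions.
Bounded denominators make the minimum exist and be rational, so `min K ρ` is an admissible metric
(`IsDistanceData.exists_metric`). The truncated distances must be prescribed, since only they agree
on `G₀`. From `m₁ ≤ ρ₁` one gets `min K ρ ≤ m₁` on `G₁`. The substance is the converse: no
decomposition inside `Γ` gives a sum below `m₁` (`CompatibleEDist.le_sum`).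

For this, `Γ` is made to act by isometries on a pseudometric space in which `g` and `h` from a
factor move every point to points at distance at most `dᵢ g h`, while one orbit of `G₁` is an
isometric copy of `G₁`. The distance between two products applied to the base point is then at most
the sum of the factor distances.

The space is the limit of a tower. It starts with `G₁` acting on itself; each step induces the
current space from `G₀` to the other group, gluing in the part on which that group already acts.
Each stage embeds isometrically in the next because a shift by an element of `G₀` costs as much as
it can displace a point (`toInduced`), and the actions extend up to distance zero
(`toInduced_smul`).

Joint embedding is amalgamation over the free group of rank zero. Countability holds because
finitely many rational distances determine an object up to isomorphism. -/

/-- A bi-invariant extended pseudodistance on a group. -/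
structure IsBiInvariantEDist {G : Type u} [Group G] (d : G → G → ENNReal) : Prop where
  self : ∀ a, d a a = 0
  comm : ∀ a b, d a b = d b a
  triangle : ∀ a b c, d a c ≤ d a b + d b c
  mul_left : ∀ c a b, d (c * a) (c * b) = d a b
  mul_right : ∀ a b c, d (a * c) (b * c) = d a b

/-- A set with an extended pseudodistance on which `G` acts isometrically, the displacements
being bounded by the given distance `d` of `G`. -/
structure DisplacementSpace (G : Type u) [Group G] (d : G → G → ENNReal) where
  carrier : Type u
  [action : MulAction G carrier]
  D : carrier → carrier → ENNReal
  self : ∀ x, D x x = 0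
  comm : ∀ x y, D x y = D y x
  triangle : ∀ x y z, D x z ≤ D x y + D y z
  smul : ∀ (g : G) x y, D (g • x) (g • y) = D x y
  displacement : ∀ (g h : G) x, D (g • x) (h • x) ≤ d g h

namespace DisplacementSpace

attribute [instance] DisplacementSpace.action

section Basic

variable {G : Type u} [Group G] {d : G → G → ENNReal} (A : DisplacementSpace G d)

theorem D_le_of_left {x x' y : A.carrier} (h : A.D x x' = 0) : A.D x y ≤ A.D x' y := by
  simpa [h] using A.triangle x x' y

theorem D_eq_of_left {x x' y : A.carrier} (h : A.D x x' = 0) : A.D x y = A.D x' y :=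
  le_antisymm (A.D_le_of_left h) (A.D_le_of_left (by rwa [A.comm]))

theorem D_eq_of_right {x y y' : A.carrier} (h : A.D y y' = 0) : A.D x y = A.D x y' := by
  rw [A.comm x y, A.comm x y', A.D_eq_of_left h]

/-- The group acting on itself by left translations. -/
def regular (hd : IsBiInvariantEDist d) : DisplacementSpace G d where
  carrier := G
  D := d
  self := hd.self
  comm := hd.comm
  triangle := hd.triangle
  smul := hd.mul_left
  displacement g h x := (hd.mul_right g h x).le

/-- The empty space. -/
def empty (G : Type u) [Group G] (d : G → G → ENNReal) : DisplacementSpace G d where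
  carrier := PEmpty
  action := { smul := fun _ x => x, one_smul := fun _ => rfl, mul_smul := fun _ _ _ => rfl }
  D x := x.elim
  self x := x.elim
  comm x := x.elim
  triangle x := x.elim
  smul _ x := x.elim
  displacement _ _ x := x.elim

end Basic

/-! ### Inducing a space from a common subgroup, relative to a subspace with an action -/

section Induction

variable {G₀ G H : Type u} [Group G₀] [Group G] [Group H]
  {d : G → G → ENNReal} {e : H → H → ENNReal}

/-- A distance preserving map which is equivariant, up to distance zero, for the actions of a
third group. -/
structure Embedding (j : G₀ →* G) (k : G₀ →* H) (A : DisplacementSpace G d)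
    (B : DisplacementSpace H e) where
  toFun : A.carrier → B.carrier
  isometry : ∀ x y, B.D (toFun x) (toFun y) = A.D x y
  equivariant : ∀ h x, B.D (toFun (j h • x)) (k h • toFun x) = 0

variable {j : G₀ →* G} {k : G₀ →* H} {A : DisplacementSpace G d} {B : DisplacementSpace H e}

/-- The length of the paths between two points of the induced space: `Sum.inl h` moves an
element of `G₀` between the two factors, `Sum.inr (p, q)` passes through the points `p` and `q`
of the subspace on which the whole group already acts. -/
def inducedCost (f : Embedding j k A B) (i : G₀ ⊕ A.carrier × A.carrier)
    (u v : G × B.carrier) : ENNReal :=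
  match i with
  | Sum.inl h => d u.1 (v.1 * j h) + B.D (k h • u.2) v.2
  | Sum.inr (p, q) =>
    B.D u.2 (f.toFun p) + A.D (u.1 • p) (v.1 • q) + B.D (f.toFun q) v.2

variable (hd : IsBiInvariantEDist d) (f : Embedding j k A B)

include hd in
theorem exists_inducedCost_comm (i) (u v : G × B.carrier) :
    ∃ i', inducedCost f i' v u ≤ inducedCost f i u v := by
  obtain ⟨a, x⟩ := u
  obtain ⟨b, y⟩ := v
  rcases i with h | ⟨p, q⟩
  · refine ⟨Sum.inl h⁻¹, le_of_eq ?_⟩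
    simp only [inducedCost]
    rw [B.comm, ← B.smul (k h), hd.comm, ← hd.mul_right _ _ (j h)]
    simp
  · refine ⟨Sum.inr (q, p), le_of_eq ?_⟩
    simp only [inducedCost]
    rw [B.comm, A.comm, B.comm _ x]
    ring

-- Two consecutive paths can be shortened to a single one: shifts compose, a shift is absorbed into
-- an adjacent passage through `A`, and two passages merge because the stretch between them lies in
-- `B`, where `A` sits isometrically. Hence the infimum over single paths already satisfies the
-- triangle inequality and no chains are needed.
include hd in
theorem exists_inducedCost_trans (i i') (u v w : G × B.carrier) :
    ∃ l, inducedCost f l u w ≤ inducedCost f i u v + inducedCost f i' v w := by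
  obtain ⟨a, x⟩ := u
  obtain ⟨b, y⟩ := v
  obtain ⟨c, z⟩ := w
  rcases i with h | ⟨p, q⟩ <;> rcases i' with h' | ⟨r, s⟩
  · refine ⟨Sum.inl (h' * h), ?_⟩
    simp only [inducedCost, map_mul, mul_smul, ← mul_assoc]
    calc _ ≤ (d a (b * j h) + d (b * j h) (c * j h' * j h)) +
          (B.D (k h' • k h • x) (k h' • y) + B.D (k h' • y) z) :=
          add_le_add (hd.triangle _ _ _) (B.triangle _ _ _)
      _ = _ := by rw [hd.mul_right, B.smul]; ring
  -- Shifting by `h` and then entering `A` at `r` amounts to entering at the translate of `r` by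
  -- `h⁻¹`.
  · refine ⟨Sum.inr (j h⁻¹ • r, s), ?_⟩
    simp only [inducedCost]
    have h1 : B.D x (f.toFun (j h⁻¹ • r)) ≤ B.D (k h • x) y + B.D y (f.toFun r) := by
      rw [B.D_eq_of_right (f.equivariant _ _), ← B.smul (k h)]
      simpa using B.triangle (k h • x) y (f.toFun r)
    have h2 : A.D (a • j h⁻¹ • r) (c • s) ≤ d a (b * j h) + A.D (b • r) (c • s) := by
      refine (A.triangle _ (b • r) _).trans (add_le_add_left ?_ _)
      rw [smul_smul]
      refine (A.displacement _ _ _).trans (le_of_eq ?_)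
      rw [← hd.mul_right _ _ (j h)]
      simp
    calc _ ≤ (B.D (k h • x) y + B.D y (f.toFun r)) +
          (d a (b * j h) + A.D (b • r) (c • s)) + B.D (f.toFun s) z := by gcongr
      _ = _ := by ring
  · refine ⟨Sum.inr (p, j h' • q), ?_⟩
    simp only [inducedCost]
    have h1 : B.D (f.toFun (j h' • q)) z ≤ B.D (f.toFun q) y + B.D (k h' • y) z := by
      rw [B.D_eq_of_left (f.equivariant _ _), ← B.smul (k h') (f.toFun q)]
      exact B.triangle _ _ _
    have h2 : A.D (a • p) (c • j h' • q) ≤ A.D (a • p) (b • q) + d b (c * j h') := by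
      refine (A.triangle _ (b • q) _).trans (add_le_add_right ?_ _)
      rw [smul_smul]
      exact A.displacement _ _ _
    calc _ ≤ B.D x (f.toFun p) + (A.D (a • p) (b • q) + d b (c * j h')) +
          (B.D (f.toFun q) y + B.D (k h' • y) z) := by gcongr
      _ = _ := by ring
  · refine ⟨Sum.inr (p, s), ?_⟩
    simp only [inducedCost]
    have h1 : A.D (b • q) (b • r) ≤ B.D (f.toFun q) y + B.D y (f.toFun r) := by
      rw [A.smul, ← f.isometry]
      exact B.triangle _ _ _
    have h2 : A.D (a • p) (c • s) ≤ A.D (a • p) (b • q) +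
        (B.D (f.toFun q) y + B.D y (f.toFun r)) + A.D (b • r) (c • s) :=
      (A.triangle _ (b • r) _).trans (add_le_add_left
        ((A.triangle _ (b • q) _).trans (add_le_add_right h1 _)) _)
    calc _ ≤ B.D x (f.toFun p) + (A.D (a • p) (b • q) +
        (B.D (f.toFun q) y + B.D y (f.toFun r)) + A.D (b • r) (c • s)) +
          B.D (f.toFun s) z := by gcongr
      _ = _ := by ring

/-- The space induced from `B` for the action of `G`, in which the subspace `A` keeps the
action of `G` which it already carries. -/
noncomputable def induced : DisplacementSpace G d where
  carrier := G × B.carrier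
  action :=
    { smul := fun g u => (g * u.1, u.2)
      one_smul := fun u => Prod.ext (one_mul _) rfl
      mul_smul := fun _ _ _ => Prod.ext (mul_assoc _ _ _) rfl }
  D u v := ⨅ i, inducedCost f i u v
  self u := by
    refine le_antisymm (iInf_le_of_le (Sum.inl 1) ?_) zero_le
    simp [inducedCost, hd.self, B.self]
  comm u v := by
    refine le_antisymm (le_iInf fun i => ?_) (le_iInf fun i => ?_)
    · obtain ⟨i', h⟩ := exists_inducedCost_comm hd f i v u
      exact iInf_le_of_le i' h
    · obtain ⟨i', h⟩ := exists_inducedCost_comm hd f i u v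
      exact iInf_le_of_le i' h
  triangle u v w := by
    simp only [ENNReal.iInf_add, ENNReal.add_iInf]
    refine le_iInf fun i => le_iInf fun i' => ?_
    obtain ⟨l, h⟩ := exists_inducedCost_trans hd f i' i u v w
    exact iInf_le_of_le l h
  smul g u v := by
    refine iInf_congr fun i => ?_
    obtain ⟨a, x⟩ := u
    obtain ⟨b, y⟩ := v
    change inducedCost f i (g * a, x) (g * b, y) = _
    rcases i with h | ⟨p, q⟩
    · simp only [inducedCost, mul_assoc, hd.mul_left]
    · simp only [inducedCost, mul_smul, A.smul]
  displacement g h u := by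
    refine iInf_le_of_le (Sum.inl 1) ?_
    change inducedCost f _ (g * u.1, u.2) (h * u.1, u.2) ≤ _
    simp [inducedCost, hd.mul_right, B.self]

variable (hde : ∀ h, d 1 (j h) = e 1 (k h))

/-- The embedding of a space into the induced space. -/
noncomputable def toInduced : Embedding k j B (induced hd f) where
  toFun x := (1, x)
  isometry x y := by
    change (⨅ i, inducedCost f i (1, x) (1, y)) = _
    refine le_antisymm (iInf_le_of_le (Sum.inl 1) ?_) (le_iInf fun i => ?_)
    · simp [inducedCost, hd.self]
    -- No path is a shortcut: by `hde` a shift costs `e 1 (k h)`, which bounds the displacement of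
    -- `x` by `k h`, and a passage through `A` has the length it has in `B`.
    · rcases i with h | ⟨p, q⟩
      · simp only [inducedCost, one_mul, hde]
        refine (B.triangle x (k h • x) y).trans (add_le_add_left ?_ _)
        simpa using B.displacement 1 (k h) x
      · simp only [inducedCost, one_smul, ← f.isometry]
        exact (B.triangle _ (f.toFun q) _).trans (add_le_add_left (B.triangle _ _ _) _)
  equivariant h x := by
    refine le_antisymm (iInf_le_of_le (Sum.inl h⁻¹) ?_) zero_le
    change inducedCost f _ (1, k h • x) (j h * 1, x) ≤ _
    simp [inducedCost, hd.self, B.self]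

/-- The passage through `A` from `g • x` to `x` costs nothing, since both ends represent the same
point of `A`. This is what makes the new action extend the old one. -/
theorem toInduced_smul (g : G) (x : A.carrier) :
    (induced hd f).D ((toInduced hd f hde).toFun (f.toFun (g • x)))
      (g • (toInduced hd f hde).toFun (f.toFun x)) = 0 := by
  refine le_antisymm (iInf_le_of_le (Sum.inr (g • x, x)) ?_) zero_le
  change inducedCost f _ (1, f.toFun (g • x)) (g * 1, f.toFun x) ≤ _
  simp [inducedCost, A.self, B.self]

end Induction

end DisplacementSpace

/-! ### Bi-invariant distances extend to amalgamated products -/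

/-- Two bi-invariant distances which agree on a common subgroup. -/
structure CompatibleEDist {G₀ G₁ G₂ : Type u} [Group G₀] [Group G₁] [Group G₂]
    (j₁ : G₀ →* G₁) (j₂ : G₀ →* G₂) (d₁ : G₁ → G₁ → ENNReal) (d₂ : G₂ → G₂ → ENNReal) :
    Prop where
  left : IsBiInvariantEDist d₁
  right : IsBiInvariantEDist d₂
  agree : ∀ h, d₁ 1 (j₁ h) = d₂ 1 (j₂ h)

theorem CompatibleEDist.symm {G₀ G₁ G₂ : Type u} [Group G₀] [Group G₁] [Group G₂]
    {j₁ : G₀ →* G₁} {j₂ : G₀ →* G₂} {d₁ : G₁ → G₁ → ENNReal} {d₂ : G₂ → G₂ → ENNReal}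
    (hc : CompatibleEDist j₁ j₂ d₁ d₂) : CompatibleEDist j₂ j₁ d₂ d₁ :=
  ⟨hc.right, hc.left, fun h => (hc.agree h).symm⟩

theorem Filter.eventually_atTop_add_one_iff {p : ℕ → Prop} :
    (∀ᶠ n in atTop, p (n + 1)) ↔ ∀ᶠ n in atTop, p n := by
  conv_rhs => rw [← map_add_atTop_eq_nat 1, eventually_map]

section Tower

open DisplacementSpace Filter

variable {G₀ G₁ G₂ : Type u} [Group G₀] [Group G₁] [Group G₂]
  {j₁ : G₀ →* G₁} {j₂ : G₀ →* G₂} {d₁ : G₁ → G₁ → ENNReal} {d₂ : G₂ → G₂ → ENNReal}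

/-- A space for `G₁` embedded into a space for `G₂`. -/
structure EmbeddedPair (j₁ : G₀ →* G₁) (j₂ : G₀ →* G₂) (d₁ : G₁ → G₁ → ENNReal)
    (d₂ : G₂ → G₂ → ENNReal) where
  A : DisplacementSpace G₁ d₁
  B : DisplacementSpace G₂ d₂
  emb : Embedding j₁ j₂ A B

namespace EmbeddedPair

variable (hc : CompatibleEDist j₁ j₂ d₁ d₂)

/-- The group `G₁` in the space for `G₂` induced from it. -/
noncomputable def initial : EmbeddedPair j₁ j₂ d₁ d₂ where
  A := regular hc.left
  B := induced (j := j₂) (k := j₁) (A := DisplacementSpace.empty G₂ d₂) hc.right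
    ⟨fun x => x.elim, fun x => x.elim, fun _ x => x.elim⟩
  emb := toInduced _ _ hc.symm.agree

/-- One step of the tower: the `G₂`-space is made part of a `G₁`-space, which is then made part
of a `G₂`-space. -/
noncomputable def next (S : EmbeddedPair j₁ j₂ d₁ d₂) : EmbeddedPair j₁ j₂ d₁ d₂ where
  A := induced hc.left S.emb
  B := induced hc.right (toInduced hc.left S.emb hc.agree)
  emb := toInduced hc.right _ hc.symm.agree

/-- The embedding of the `G₂`-space into the next `G₁`-space. -/
noncomputable def link (S : EmbeddedPair j₁ j₂ d₁ d₂) : Embedding j₂ j₁ S.B (S.next hc).A :=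
  toInduced hc.left S.emb hc.agree

theorem link_emb_smul (S : EmbeddedPair j₁ j₂ d₁ d₂) (g : G₁) (x : S.A.carrier) :
    (S.next hc).A.D ((S.link hc).toFun (S.emb.toFun (g • x)))
      (g • (S.link hc).toFun (S.emb.toFun x)) = 0 :=
  toInduced_smul hc.left S.emb hc.agree g x

theorem emb_link_smul (S : EmbeddedPair j₁ j₂ d₁ d₂) (g : G₂) (y : S.B.carrier) :
    (S.next hc).B.D ((S.next hc).emb.toFun ((S.link hc).toFun (g • y)))
      (g • (S.next hc).emb.toFun ((S.link hc).toFun y)) = 0 :=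
  toInduced_smul hc.right (S.link hc) hc.symm.agree g y

/-- The tower of spaces generated by `G₁`. -/
noncomputable def tower : ℕ → EmbeddedPair j₁ j₂ d₁ d₂
  | 0 => initial hc
  | n + 1 => (tower n).next hc

/-- The embedding of one `G₁`-space of the tower into the next. -/
noncomputable def up (n : ℕ) (x : (tower hc n).A.carrier) : (tower hc (n + 1)).A.carrier :=
  ((tower hc n).link hc).toFun ((tower hc n).emb.toFun x)

theorem D_up (n : ℕ) (x y : (tower hc n).A.carrier) :
    (tower hc (n + 1)).A.D (up hc n x) (up hc n y) = (tower hc n).A.D x y :=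
  (((tower hc n).link hc).isometry _ _).trans ((tower hc n).emb.isometry _ _)

theorem D_up_smul (n : ℕ) (g : G₁) (x : (tower hc n).A.carrier) :
    (tower hc (n + 1)).A.D (up hc n (g • x)) (g • up hc n x) = 0 :=
  link_emb_smul hc (tower hc n) g x

/-- An element of `G₂` acts on a `G₁`-space of the tower with values in the next one. -/
noncomputable def right (n : ℕ) (g : G₂) (x : (tower hc n).A.carrier) :
    (tower hc (n + 1)).A.carrier :=
  ((tower hc n).link hc).toFun (g • (tower hc n).emb.toFun x)

theorem D_right (n : ℕ) (g : G₂) (x y : (tower hc n).A.carrier) :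
    (tower hc (n + 1)).A.D (right hc n g x) (right hc n g y) = (tower hc n).A.D x y :=
  (((tower hc n).link hc).isometry _ _).trans
    (((tower hc n).B.smul _ _ _).trans ((tower hc n).emb.isometry _ _))

theorem D_right_le (n : ℕ) (g h : G₂) (x : (tower hc n).A.carrier) :
    (tower hc (n + 1)).A.D (right hc n g x) (right hc n h x) ≤ d₂ g h :=
  (((tower hc n).link hc).isometry _ _).trans_le ((tower hc n).B.displacement _ _ _)

theorem right_one (n : ℕ) (x : (tower hc n).A.carrier) : right hc n 1 x = up hc n x := by
  rw [right, one_smul, up]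

theorem D_right_base (n : ℕ) (h : G₀) (x : (tower hc n).A.carrier) :
    (tower hc (n + 1)).A.D (right hc n (j₂ h) x) (j₁ h • up hc n x) = 0 :=
  ((tower hc n).link hc).equivariant _ _

theorem D_right_up (n : ℕ) (g : G₂) (x : (tower hc n).A.carrier) :
    (tower hc (n + 2)).A.D (right hc (n + 1) g (up hc n x)) (up hc (n + 1) (right hc n g x)) =
      0 := by
  rw [(tower hc (n + 2)).A.comm]
  exact (((tower hc (n + 1)).link hc).isometry _ _).trans (emb_link_smul hc (tower hc n) g _)

/-- Each application of `G₂` climbs one level, so acting twice lands one level above acting once by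
the product; the two can only be compared after applying `up`. -/
theorem D_right_right (n : ℕ) (g h : G₂) (x : (tower hc n).A.carrier) :
    (tower hc (n + 2)).A.D (right hc (n + 1) g (right hc n h x))
      (up hc (n + 1) (right hc n (g * h) x)) = 0 := by
  rw [(tower hc (n + 2)).A.comm]
  refine (((tower hc (n + 1)).link hc).isometry _ _).trans ?_
  have := emb_link_smul hc (tower hc n) g (h • (tower hc n).emb.toFun x)
  rwa [smul_smul] at this

/-! ### The limit of the tower -/

/-- A point of the limit of the tower. -/
def Thread : Type u :=
  {x : ∀ n, (tower hc n).A.carrier //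
    ∀ᶠ n in atTop, (tower hc (n + 1)).A.D (x (n + 1)) (up hc n (x n)) = 0}

/-- The eventual distance of two threads is at most `r`. -/
def Thread.Within (r : ENNReal) (x y : Thread hc) : Prop :=
  ∀ᶠ n in atTop, (tower hc n).A.D (x.1 n) (y.1 n) ≤ r

variable {hc}

theorem Thread.Within.symm {r : ENNReal} {x y : Thread hc} (h : Within hc r x y) :
    Within hc r y x := by
  filter_upwards [h] with n hn
  rwa [(tower hc n).A.comm]

theorem Thread.Within.trans {r s : ENNReal} {x y z : Thread hc} (h : Within hc r x y)
    (h' : Within hc s y z) : Within hc (r + s) x z := by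
  filter_upwards [h, h'] with n hn hn'
  exact ((tower hc n).A.triangle _ _ _).trans (add_le_add hn hn')

variable (hc)

theorem Thread.Within.refl (x : Thread hc) : Within hc 0 x x :=
  Eventually.of_forall fun n => ((tower hc n).A.self _).le

instance threadSetoid : Setoid (Thread hc) where
  r := Thread.Within hc 0
  iseqv := ⟨Thread.Within.refl hc, fun h => h.symm, fun h h' => by simpa using h.trans h'⟩

/-- The limit of the tower. -/
def Limit : Type u := Quotient (threadSetoid hc)

/-- The distance of two points of the limit is at most `r`. -/
def Limit.Within (r : ENNReal) (x y : Limit hc) : Prop :=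
  ∃ x' y' : Thread hc, Quotient.mk _ x' = x ∧ Quotient.mk _ y' = y ∧ Thread.Within hc r x' y'

theorem Limit.within_mk {r : ENNReal} {x y : Thread hc} :
    Within hc r (Quotient.mk _ x) (Quotient.mk _ y) ↔ Thread.Within hc r x y := by
  refine ⟨fun ⟨x', y', hx, hy, h⟩ => ?_, fun h => ⟨x, y, rfl, rfl, h⟩⟩
  have hx : Thread.Within hc 0 x x' := (Quotient.exact hx).symm
  have hy : Thread.Within hc 0 y' y := Quotient.exact hy
  simpa using (hx.trans h).trans hy

theorem Limit.within_refl (x : Limit hc) : Within hc 0 x x := by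
  induction x using Quotient.inductionOn with
  | h x => exact (within_mk hc).2 (Thread.Within.refl hc x)

variable {hc} in
theorem Limit.Within.trans {r s : ENNReal} {x y z : Limit hc} (h : Within hc r x y)
    (h' : Within hc s y z) : Within hc (r + s) x z := by
  induction x using Quotient.inductionOn
  induction y using Quotient.inductionOn
  induction z using Quotient.inductionOn
  exact (within_mk hc).2 (((within_mk hc).1 h).trans ((within_mk hc).1 h'))

/-! ### The actions of both groups on the limit -/

/-- The action of `G₁` on threads. -/
noncomputable def Thread.leftSMul (g : G₁) (x : Thread hc) : Thread hc :=
  ⟨fun n => g • x.1 n, by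
    filter_upwards [x.2] with n hn
    rw [(tower hc (n + 1)).A.D_eq_of_right (D_up_smul hc n g _), (tower hc (n + 1)).A.smul, hn]⟩

/-- The action of `G₂` on threads. -/
noncomputable def Thread.rightSMul (g : G₂) (x : Thread hc) : Thread hc :=
  ⟨fun n => match n with
    -- A filler: only the eventual behaviour of a thread matters.
    | 0 => x.1 0
    | n + 1 => right hc n g (x.1 n), by
    rw [← eventually_atTop_add_one_iff]
    filter_upwards [x.2] with n hn
    change (tower hc (n + 2)).A.D (right hc (n + 1) g (x.1 (n + 1)))
      (up hc (n + 1) (right hc n g (x.1 n))) = 0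
    rw [← (tower hc (n + 2)).A.D_eq_of_right (D_right_up hc n g (x.1 n)), D_right, hn]⟩

theorem Thread.within_succ_iff {r : ENNReal} {x y : Thread hc} :
    Within hc r x y ↔
      ∀ᶠ n in atTop, (tower hc (n + 1)).A.D (x.1 (n + 1)) (y.1 (n + 1)) ≤ r :=
  (eventually_atTop_add_one_iff (p := fun n => (tower hc n).A.D (x.1 n) (y.1 n) ≤ r)).symm

theorem Thread.within_leftSMul {r : ENNReal} {x y : Thread hc} (g : G₁) (h : Within hc r x y) :
    Within hc r (leftSMul hc g x) (leftSMul hc g y) := by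
  filter_upwards [h] with n hn
  exact ((tower hc n).A.smul _ _ _).trans_le hn

theorem Thread.within_rightSMul {r : ENNReal} {x y : Thread hc} (g : G₂) (h : Within hc r x y) :
    Within hc r (rightSMul hc g x) (rightSMul hc g y) := by
  rw [within_succ_iff]
  filter_upwards [h] with n hn
  exact (D_right hc n g _ _).trans_le hn

/-- The action of `G₁` on the limit. -/
noncomputable abbrev leftAction : MulAction G₁ (Limit hc) where
  smul g := Quotient.map (Thread.leftSMul hc g) fun _ _ h => Thread.within_leftSMul hc g h
  one_smul x := by
    induction x using Quotient.inductionOn with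
    | h x =>
      exact congrArg (Quotient.mk _) (Subtype.ext (funext fun n => one_smul _ _))
  mul_smul g h x := by
    induction x using Quotient.inductionOn with
    | h x =>
      exact congrArg (Quotient.mk _) (Subtype.ext (funext fun n => mul_smul _ _ _))

/-- The action of `G₂` on the limit. -/
noncomputable abbrev rightAction : MulAction G₂ (Limit hc) where
  smul g := Quotient.map (Thread.rightSMul hc g) fun _ _ h => Thread.within_rightSMul hc g h
  one_smul x := by
    induction x using Quotient.inductionOn with
    | h x =>
      refine Quotient.sound ((Thread.within_succ_iff hc).2 ?_)
      filter_upwards [x.2] with n hn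
      change (tower hc (n + 1)).A.D (right hc n 1 (x.1 n)) (x.1 (n + 1)) ≤ 0
      rw [right_one, (tower hc (n + 1)).A.comm, hn]
  mul_smul g h x := by
    induction x using Quotient.inductionOn with
    | h x =>
      refine Quotient.sound ((Thread.within_succ_iff hc).2 ?_)
      rw [← eventually_atTop_add_one_iff]
      filter_upwards [x.2] with n hn
      change (tower hc (n + 2)).A.D (right hc (n + 1) (g * h) (x.1 (n + 1)))
        (right hc (n + 1) g (right hc n h (x.1 n))) ≤ 0
      rw [(tower hc (n + 2)).A.D_eq_of_right (D_right_right hc n g h _),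
        ← (tower hc (n + 2)).A.D_eq_of_right (D_right_up hc n (g * h) _), D_right, hn]

/-- The representation of `G₁` on the limit. -/
noncomputable def leftHom : G₁ →* Equiv.Perm (Limit hc) :=
  letI := leftAction hc
  MulAction.toPermHom G₁ (Limit hc)

/-- The representation of `G₂` on the limit. -/
noncomputable def rightHom : G₂ →* Equiv.Perm (Limit hc) :=
  letI := rightAction hc
  MulAction.toPermHom G₂ (Limit hc)

theorem leftHom_mk (g : G₁) (x : Thread hc) :
    leftHom hc g (Quotient.mk _ x) = Quotient.mk _ (Thread.leftSMul hc g x) := rfl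

theorem rightHom_mk (g : G₂) (x : Thread hc) :
    rightHom hc g (Quotient.mk _ x) = Quotient.mk _ (Thread.rightSMul hc g x) := rfl

/-- The agreement on `G₀` comes from the equivariance of `link`. It is what lets the two
representations combine into one of the amalgam. -/
theorem leftHom_comp_eq : (leftHom hc).comp j₁ = (rightHom hc).comp j₂ := by
  refine MonoidHom.ext fun h => Equiv.ext fun x => ?_
  induction x using Quotient.inductionOn with
  | h x =>
    refine Quotient.sound ((Thread.within_succ_iff hc).2 ?_)
    filter_upwards [x.2] with n hn
    change (tower hc (n + 1)).A.D (j₁ h • x.1 (n + 1)) (right hc n (j₂ h) (x.1 n)) ≤ 0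
    rw [(tower hc (n + 1)).A.D_eq_of_right (D_right_base hc n h _),
      (tower hc (n + 1)).A.smul, hn]

theorem within_leftHom {r : ENNReal} {x y : Limit hc} (g : G₁) (h : Limit.Within hc r x y) :
    Limit.Within hc r (leftHom hc g x) (leftHom hc g y) := by
  induction x using Quotient.inductionOn
  induction y using Quotient.inductionOn
  simp only [leftHom_mk, Limit.within_mk] at h ⊢
  exact Thread.within_leftSMul hc g h

theorem within_rightHom {r : ENNReal} {x y : Limit hc} (g : G₂) (h : Limit.Within hc r x y) :
    Limit.Within hc r (rightHom hc g x) (rightHom hc g y) := by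
  induction x using Quotient.inductionOn
  induction y using Quotient.inductionOn
  simp only [rightHom_mk, Limit.within_mk] at h ⊢
  exact Thread.within_rightSMul hc g h

theorem within_leftHom_leftHom (g h : G₁) (x : Limit hc) :
    Limit.Within hc (d₁ g h) (leftHom hc g x) (leftHom hc h x) := by
  induction x using Quotient.inductionOn with
  | h x =>
    simp only [leftHom_mk, Limit.within_mk]
    exact Eventually.of_forall fun n => (tower hc n).A.displacement _ _ _

theorem within_rightHom_rightHom (g h : G₂) (x : Limit hc) :
    Limit.Within hc (d₂ g h) (rightHom hc g x) (rightHom hc h x) := by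
  induction x using Quotient.inductionOn with
  | h x =>
    simp only [rightHom_mk, Limit.within_mk, Thread.within_succ_iff]
    exact Eventually.of_forall fun n => D_right_le hc n _ _ _

/-- The images of the unit of `G₁` in the spaces of the tower. -/
noncomputable def unit : ∀ n, (tower hc n).A.carrier
  | 0 => (1 : G₁)
  | n + 1 => up hc n (unit n)

/-- The unit of `G₁` as a point of the limit. -/
noncomputable def unitThread : Thread hc :=
  ⟨unit hc, Eventually.of_forall fun n => (tower hc (n + 1)).A.self _⟩

theorem D_smul_unit (a b : G₁) (n : ℕ) :
    (tower hc n).A.D (a • unit hc n) (b • unit hc n) = d₁ a b := by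
  induction n with
  | zero =>
    change d₁ (a * 1) (b * 1) = _
    simp
  | succ n ih =>
    change (tower hc (n + 1)).A.D (a • up hc n (unit hc n)) (b • up hc n (unit hc n)) = _
    rw [← (tower hc (n + 1)).A.D_eq_of_left (D_up_smul hc n a _),
      ← (tower hc (n + 1)).A.D_eq_of_right (D_up_smul hc n b _), D_up, ih]

/-- The orbit of the unit carries the distance `d₁` at every level of the tower, so a single level
witnessing the bound suffices. -/
theorem le_of_within_unit {r : ENNReal} {a b : G₁}
    (h : Limit.Within hc r (leftHom hc a (Quotient.mk _ (unitThread hc)))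
      (leftHom hc b (Quotient.mk _ (unitThread hc)))) : d₁ a b ≤ r := by
  simp only [leftHom_mk, Limit.within_mk] at h
  obtain ⟨n, hn⟩ := h.exists
  rwa [← D_smul_unit hc a b n]

end EmbeddedPair

/-! ### Lower bound for decomposition sums in an amalgam -/

/-- Two homomorphisms extend along `ψ₁` and `ψ₂` as soon as they agree on the common subgroup. -/
def ExtendsAmalgam {Γ : Type u} [Group Γ] (j₁ : G₀ →* G₁) (j₂ : G₀ →* G₂) (ψ₁ : G₁ →* Γ)
    (ψ₂ : G₂ →* Γ) : Prop :=
  ∀ (P : Type u) [Group P] (f₁ : G₁ →* P) (f₂ : G₂ →* P), f₁.comp j₁ = f₂.comp j₂ →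
    ∃ f : Γ →* P, f.comp ψ₁ = f₁ ∧ f.comp ψ₂ = f₂

theorem ExtendsAmalgam.symm {Γ : Type u} [Group Γ] {ψ₁ : G₁ →* Γ} {ψ₂ : G₂ →* Γ}
    (h : ExtendsAmalgam j₁ j₂ ψ₁ ψ₂) : ExtendsAmalgam j₂ j₁ ψ₂ ψ₁ := fun P _ f₁ f₂ hf =>
  let ⟨f, hf₁, hf₂⟩ := h P f₂ f₁ hf.symm
  ⟨f, hf₂, hf₁⟩

/-- The elements of the amalgam given by a pair of elements of one of the factors. -/
def amalgamPair {Γ : Type u} [Group Γ] (ψ₁ : G₁ →* Γ) (ψ₂ : G₂ →* Γ) :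
    (G₁ × G₁) ⊕ (G₂ × G₂) → Γ × Γ :=
  Sum.elim (Prod.map ψ₁ ψ₁) (Prod.map ψ₂ ψ₂)

/-- A bi-invariant distance is not decreased in an amalgam: simultaneous decompositions into
elements of the factors do not lead to smaller distances. -/
theorem CompatibleEDist.le_sum (hc : CompatibleEDist j₁ j₂ d₁ d₂) {Γ : Type u} [Group Γ]
    {ψ₁ : G₁ →* Γ} {ψ₂ : G₂ →* Γ} (hψ : ExtendsAmalgam j₁ j₂ ψ₁ ψ₂) {a b : G₁}
    (l : List ((G₁ × G₁) ⊕ (G₂ × G₂)))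
    (ha : (l.map fun p => (amalgamPair ψ₁ ψ₂ p).1).prod = ψ₁ a)
    (hb : (l.map fun p => (amalgamPair ψ₁ ψ₂ p).2).prod = ψ₁ b) :
    d₁ a b ≤ (l.map (Sum.elim (Function.uncurry d₁) (Function.uncurry d₂))).sum := by
  obtain ⟨f, hf₁, hf₂⟩ := hψ _ (EmbeddedPair.leftHom hc) (EmbeddedPair.rightHom hc)
    (EmbeddedPair.leftHom_comp_eq hc)
  replace hf₁ : ∀ g, f (ψ₁ g) = EmbeddedPair.leftHom hc g := fun g => DFunLike.congr_fun hf₁ g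
  replace hf₂ : ∀ g, f (ψ₂ g) = EmbeddedPair.rightHom hc g := fun g => DFunLike.congr_fun hf₂ g
  apply EmbeddedPair.le_of_within_unit hc
  rw [← hf₁, ← hf₁, ← ha, ← hb]
  -- From here on the base point plays no role: displacements are bounded at every point.
  generalize Quotient.mk _ (EmbeddedPair.unitThread hc) = x
  clear ha hb
  induction l with
  | nil =>
    simp only [List.map_nil, List.prod_nil, List.sum_nil, map_one]
    exact EmbeddedPair.Limit.within_refl hc x
  | cons p l ih =>
    simp only [List.map_cons, List.prod_cons, List.sum_cons, map_mul]
    -- First replace the tail of the product, which the head moves isometrically, then replace the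
    -- head, at the cost of its displacement.
    rw [add_comm]
    rcases p with ⟨g, h⟩ | ⟨g, h⟩
    · simp only [amalgamPair, Sum.elim_inl, Prod.map, hf₁, Function.uncurry]
      exact (EmbeddedPair.within_leftHom hc _ ih).trans
        (EmbeddedPair.within_leftHom_leftHom hc _ _ _)
    · simp only [amalgamPair, Sum.elim_inr, Prod.map, hf₂, Function.uncurry]
      exact (EmbeddedPair.within_rightHom hc _ ih).trans
        (EmbeddedPair.within_rightHom_rightHom hc _ _ _)

end Tower

/-! ### Metrics generated by finitely many distances -/

/-- It puts all sums of prescribed distances into the multiples of `1 / N` by natural numbers, a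
well-ordered set. -/
theorem exists_common_denominator {Γ : Type u} {T : Set (Γ × Γ × ℝ)} (hT : T.Finite)
    (h0 : ∀ t ∈ T, 0 ≤ t.2.2) (hq : ∀ t ∈ T, ∃ q : ℚ, t.2.2 = q) :
    ∃ N : ℕ, 0 < N ∧ ∀ t ∈ T, ∃ k : ℕ, (N : ℝ) * t.2.2 = k := by
  induction T, hT using Set.Finite.induction_on with
  | empty => exact ⟨1, one_pos, by simp⟩
  | @insert t T _ _ ih =>
    obtain ⟨N, hN, ih⟩ := ih (fun t ht => h0 t (Or.inr ht)) fun t ht => hq t (Or.inr ht)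
    obtain ⟨q, hq⟩ := hq t (Or.inl rfl)
    have hq0 : 0 ≤ q := by
      have := h0 t (Or.inl rfl)
      rw [hq] at this
      exact_mod_cast this
    refine ⟨N * q.den, Nat.mul_pos hN q.den_pos, ?_⟩
    rintro s (rfl | hs)
    · refine ⟨N * q.num.toNat, ?_⟩
      have h1 : (q.den : ℚ) * q = q.num.toNat := by
        rw [Rat.den_mul_eq_num]
        exact_mod_cast (Int.toNat_of_nonneg (Rat.num_nonneg.2 hq0)).symm
      have h2 : (q.den : ℝ) * (q : ℝ) = q.num.toNat := by exact_mod_cast h1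
      rw [hq]
      push_cast
      rw [mul_assoc, h2]
    · obtain ⟨k, hk⟩ := ih s hs
      refine ⟨k * q.den, ?_⟩
      push_cast
      rw [← hk]
      ring

section Generated

variable {Γ : Type u} [Group Γ]

/-- The sums of the prescribed distances of the decompositions of `a` and `b`, where the triple
`(x, y, r)` prescribes the distance `r` for `x` and `y`. -/
def tripleSums (T : Set (Γ × Γ × ℝ)) (a b : Γ) : Set ℝ :=
  {s | ∃ l : List (Γ × Γ × ℝ), (∀ t ∈ l, t ∈ T) ∧ (l.map fun t => t.1).prod = a ∧
    (l.map fun t => t.2.1).prod = b ∧ s = (l.map fun t => t.2.2).sum}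

theorem add_mem_tripleSums {T : Set (Γ × Γ × ℝ)} {a b a' b' : Γ} {s s' : ℝ}
    (h : s ∈ tripleSums T a b) (h' : s' ∈ tripleSums T a' b') :
    s + s' ∈ tripleSums T (a * a') (b * b') := by
  obtain ⟨l, hl, rfl, rfl, rfl⟩ := h
  obtain ⟨l', hl', rfl, rfl, rfl⟩ := h'
  refine ⟨l ++ l', fun t ht => ?_, by simp, by simp, by simp⟩
  exact (List.mem_append.1 ht).elim (hl t) (hl' t)

theorem mem_tripleSums_of_mem {T : Set (Γ × Γ × ℝ)} {a b : Γ} {r : ℝ} (h : (a, b, r) ∈ T) :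
    r ∈ tripleSums T a b :=
  ⟨[(a, b, r)], by simpa using h, by simp, by simp, by simp⟩

/-- A finite set of triples which prescribes rational distances on a finite symmetric set of
generators. -/
structure IsDistanceData (A : Set Γ) (T : Set (Γ × Γ × ℝ)) : Prop where
  finite : A.Finite
  one_mem : 1 ∈ A
  inv_eq : A⁻¹ = A
  closure_eq : Subgroup.closure A = ⊤
  finite_triples : T.Finite
  mem : ∀ t ∈ T, t.1 ∈ A ∧ t.2.1 ∈ A
  nonneg : ∀ t ∈ T, 0 ≤ t.2.2
  rational : ∀ t ∈ T, ∃ q : ℚ, t.2.2 = q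
  eq_of_eq_zero : ∀ t ∈ T, t.2.2 = 0 → t.1 = t.2.1
  symm : ∀ t ∈ T, (t.2.1, t.1, t.2.2) ∈ T
  diag : ∀ a ∈ A, (a, a, (0 : ℝ)) ∈ T
  exists_one : ∀ a ∈ A, ∃ r : ℝ, (a, (1 : Γ), r) ∈ T

namespace IsDistanceData

variable {A : Set Γ} {T : Set (Γ × Γ × ℝ)} (h : IsDistanceData A T)

include h

theorem nonneg_of_mem {a b : Γ} {s : ℝ} (hs : s ∈ tripleSums T a b) : 0 ≤ s := by
  obtain ⟨l, hl, -, -, rfl⟩ := hs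
  refine List.sum_nonneg fun x hx => ?_
  obtain ⟨t, ht, rfl⟩ := List.mem_map.1 hx
  exact h.nonneg t (hl t ht)

theorem symm_mem {a b : Γ} {s : ℝ} (hs : s ∈ tripleSums T a b) : s ∈ tripleSums T b a := by
  obtain ⟨l, hl, rfl, rfl, rfl⟩ := hs
  refine ⟨l.map fun t => (t.2.1, t.1, t.2.2), fun t ht => ?_, ?_, ?_, ?_⟩
  · obtain ⟨t, ht', rfl⟩ := List.mem_map.1 ht
    exact h.symm t (hl t ht')
  all_goals simp only [List.map_map]; rfl

theorem exists_list (a : Γ) : ∃ l : List Γ, (∀ x ∈ l, x ∈ A) ∧ l.prod = a := by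
  apply Submonoid.exists_list_of_mem_closure
  have hA := Subgroup.closure_toSubmonoid A
  rw [h.inv_eq, Set.union_self, h.closure_eq] at hA
  exact hA ▸ Subgroup.mem_top a

theorem zero_mem (a : Γ) : 0 ∈ tripleSums T a a := by
  obtain ⟨l, hl, rfl⟩ := h.exists_list a
  refine ⟨l.map fun x => (x, x, 0), fun t ht => ?_, ?_, ?_, ?_⟩
  · obtain ⟨x, hx, rfl⟩ := List.mem_map.1 ht
    exact h.diag x (hl x hx)
  all_goals simp [List.map_map, Function.comp_def]

theorem exists_mem_one (a : Γ) : ∃ s, s ∈ tripleSums T a 1 := by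
  obtain ⟨l, hl, rfl⟩ := h.exists_list a
  induction l with
  | nil => exact ⟨0, h.zero_mem 1⟩
  | cons x l ih =>
    obtain ⟨s, hs⟩ := ih fun y hy => hl y (List.mem_cons_of_mem _ hy)
    obtain ⟨r, hr⟩ := h.exists_one x (hl x List.mem_cons_self)
    exact ⟨r + s, by simpa using add_mem_tripleSums (mem_tripleSums_of_mem hr) hs⟩

theorem nonempty (a b : Γ) : (tripleSums T a b).Nonempty := by
  obtain ⟨s, hs⟩ := h.exists_mem_one a
  obtain ⟨r, hr⟩ := h.exists_mem_one b
  exact ⟨s + r, by simpa using add_mem_tripleSums hs (h.symm_mem hr)⟩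

theorem eq_of_zero_mem {a b : Γ} (hs : (0 : ℝ) ∈ tripleSums T a b) : a = b := by
  obtain ⟨l, hl, rfl, rfl, h0⟩ := hs
  congr 1
  induction l with
  | nil => rfl
  | cons t l ih =>
    have ht := hl t List.mem_cons_self
    have hl' : ∀ t ∈ l, t ∈ T := fun y hy => hl y (List.mem_cons_of_mem _ hy)
    have h1 := h.nonneg t ht
    have h2 := h.nonneg_of_mem ⟨l, hl', rfl, rfl, rfl⟩
    simp only [List.map_cons, List.sum_cons] at h0
    simp only [List.map_cons]
    rw [ih hl' (by linarith), h.eq_of_eq_zero t ht (by linarith)]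

theorem exists_isLeast (a b : Γ) : ∃ s : ℝ, IsLeast (tripleSums T a b) s ∧ ∃ q : ℚ, s = q := by
  obtain ⟨N, hN, hT⟩ := exists_common_denominator h.finite_triples h.nonneg h.rational
  have hN' : (0 : ℝ) < N := by exact_mod_cast hN
  have key : ∀ s ∈ tripleSums T a b, ∃ k : ℕ, (N : ℝ) * s = k := by
    rintro s ⟨l, hl, -, -, rfl⟩
    induction l with
    | nil => exact ⟨0, by simp⟩
    | cons t l ih =>
      obtain ⟨k, hk⟩ := hT t (hl t List.mem_cons_self)
      obtain ⟨m, hm⟩ := ih fun y hy => hl y (List.mem_cons_of_mem _ hy)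
      exact ⟨k + m, by simp only [List.map_cons, List.sum_cons]; push_cast; rw [← hk, ← hm]; ring⟩
  have hne : ∃ k : ℕ, ∃ s ∈ tripleSums T a b, (N : ℝ) * s = k := by
    obtain ⟨s, hs⟩ := h.nonempty a b
    obtain ⟨k, hk⟩ := key s hs
    exact ⟨k, s, hs, hk⟩
  classical
  obtain ⟨s, hs, hk⟩ := Nat.find_spec hne
  refine ⟨s, ⟨hs, fun r hr => ?_⟩, (Nat.find hne : ℚ) / N, ?_⟩
  · obtain ⟨m, hm⟩ := key r hr
    have : (Nat.find hne : ℝ) ≤ m := by exact_mod_cast Nat.find_min' hne ⟨r, hr, hm⟩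
    rw [← hk, ← hm] at this
    exact le_of_mul_le_mul_left this hN'
  · push_cast
    rw [← hk]
    field_simp

/-- The metric generated by finitely many rational distances. -/
theorem exists_metric : ∃ ρ : MetricSpace Γ, IsFinitelyGeneratedMetric ρ ∧ IsRationalMetric ρ ∧
    ∀ a b, IsLeast (tripleSums T a b) (ρ.dist a b) := by
  choose D hD hq using h.exists_isLeast
  have hmul : ∀ a b a' b', D (a * a') (b * b') ≤ D a b + D a' b' := fun a b a' b' =>
    (hD _ _).2 (add_mem_tripleSums (hD a b).1 (hD a' b').1)
  have hself : ∀ a, D a a = 0 := fun a =>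
    le_antisymm ((hD a a).2 (h.zero_mem a)) (h.nonneg_of_mem (hD a a).1)
  let ρ : MetricSpace Γ :=
    { dist := D
      dist_self := hself
      dist_comm := fun a b =>
        le_antisymm ((hD a b).2 (h.symm_mem (hD b a).1)) ((hD b a).2 (h.symm_mem (hD a b).1))
      dist_triangle := fun a b c => by
        -- Write `a = (a * b⁻¹) * b` and `c = 1 * c`; subadditivity then gives the triangle
        -- inequality.
        have h1 := hmul (a * b⁻¹) (b * b⁻¹) b c
        have h2 := hmul a b b⁻¹ b⁻¹
        simp only [inv_mul_cancel_right, mul_inv_cancel, one_mul, hself] at h1 h2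
        linarith
      eq_of_dist_eq_zero := fun {a b} hab => h.eq_of_zero_mem (hab ▸ (hD a b).1) }
  refine ⟨ρ, ⟨A, h.finite, h.one_mem, h.inv_eq, fun a b => ?_⟩, hq, hD⟩
  have hlow : ∀ l : List (Γ × Γ), D (l.map Prod.fst).prod (l.map Prod.snd).prod ≤
      (l.map fun p => D p.1 p.2).sum := by
    intro l
    induction l with
    | nil => simp [hself]
    | cons p l ih =>
      simp only [List.map_cons, List.prod_cons, List.sum_cons]
      exact (hmul _ _ _ _).trans (add_le_add_right ih _)
  constructor
  · obtain ⟨l, hl, ha, hb, hs⟩ := (hD a b).1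
    have h1 : ((l.map fun t => (t.1, t.2.1)).map Prod.fst).prod = a := by
      rw [← ha, List.map_map]; rfl
    have h2 : ((l.map fun t => (t.1, t.2.1)).map Prod.snd).prod = b := by
      rw [← hb, List.map_map]; rfl
    refine ⟨l.map fun t => (t.1, t.2.1), fun p hp => ?_, h1, h2, ?_⟩
    · obtain ⟨t, ht, rfl⟩ := List.mem_map.1 hp
      exact h.mem t (hl t ht)
    -- On a pair from `A` the generated distance may be smaller than the prescribed one. The optimal
    -- decomposition stays optimal because `hlow` excludes any gain.
    · refine le_antisymm ?_ ?_
      · have := hlow (l.map fun t => (t.1, t.2.1))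
        rwa [h1, h2] at this
      · change _ ≤ D a b
        rw [hs, List.map_map]
        exact List.sum_le_sum fun t ht => (hD _ _).2 (mem_tripleSums_of_mem (hl t ht))
  · rintro s ⟨l, -, rfl, rfl, rfl⟩
    exact hlow l

end IsDistanceData

end Generated

/-! ### Properties of finitely generated metrics -/

section FinitelyGenerated

variable {G : Type u} [Group G]

/-- The minimum of a metric and a positive constant. -/
noncomputable abbrev MetricSpace.minConst {X : Type u} {K : ℝ} (hK : 0 < K) (ρ : MetricSpace X) :
    MetricSpace X where
  dist a b := min K (ρ.dist a b)
  dist_self a := by rw [ρ.dist_self, min_eq_right hK.le]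
  dist_comm a b := by rw [ρ.dist_comm]
  dist_triangle a b c := by
    have h1 : 0 ≤ ρ.dist a b := @dist_nonneg _ ρ.toPseudoMetricSpace a b
    have h2 : 0 ≤ ρ.dist b c := @dist_nonneg _ ρ.toPseudoMetricSpace b c
    have h3 := ρ.dist_triangle a b c
    rcases min_cases K (ρ.dist a b) with h | h <;> rcases min_cases K (ρ.dist b c) with h' | h' <;>
      rw [h.1, h'.1]
    · exact (min_le_left _ _).trans (by linarith)
    · exact (min_le_left _ _).trans (by linarith)
    · exact (min_le_left _ _).trans (by linarith)
    · exact (min_le_right _ _).trans h3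
  eq_of_dist_eq_zero {a b} h := by
    rcases min_cases K (ρ.dist a b) with h' | h'
    · exact absurd (h'.1.symm.trans h) hK.ne'
    · exact ρ.eq_of_dist_eq_zero (h'.1.symm.trans h)

/-- Concatenate optimal decompositions. Bi-invariance follows by taking one of the two pairs equal.
-/
theorem IsFinitelyGeneratedMetric.dist_mul_mul_le {m : MetricSpace G}
    (h : IsFinitelyGeneratedMetric m) (a b a' b' : G) :
    m.dist (a * a') (b * b') ≤ m.dist a b + m.dist a' b' := by
  obtain ⟨A, -, -, -, hA⟩ := h
  obtain ⟨l, hl, rfl, rfl, hs⟩ := (hA a b).1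
  obtain ⟨l', hl', rfl, rfl, hs'⟩ := (hA a' b').1
  rw [hs, hs']
  refine (hA _ _).2 ⟨l ++ l', fun p hp => ?_, by simp, by simp, by simp⟩
  exact (List.mem_append.1 hp).elim (hl p) (hl' p)

theorem IsFinitelyGeneratedMetric.dist_mul_left {m : MetricSpace G}
    (h : IsFinitelyGeneratedMetric m) (c a b : G) : m.dist (c * a) (c * b) = m.dist a b := by
  have key : ∀ c a b : G, m.dist (c * a) (c * b) ≤ m.dist a b := fun c a b => by
    simpa [m.dist_self] using h.dist_mul_mul_le c c a b
  exact le_antisymm (key c a b) (by simpa using key c⁻¹ (c * a) (c * b))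

theorem IsFinitelyGeneratedMetric.dist_mul_right {m : MetricSpace G}
    (h : IsFinitelyGeneratedMetric m) (a b c : G) : m.dist (a * c) (b * c) = m.dist a b := by
  have key : ∀ a b c : G, m.dist (a * c) (b * c) ≤ m.dist a b := fun a b c => by
    simpa [m.dist_self] using h.dist_mul_mul_le a b c c
  exact le_antisymm (key a b c) (by simpa using key (a * c) (b * c) c⁻¹)

theorem IsFinitelyGeneratedRationalMetricBoundedBy.isBiInvariantEDist {K : ℚ}
    {m : MetricSpace G} (h : IsFinitelyGeneratedRationalMetricBoundedBy K m) :
    IsBiInvariantEDist fun a b => ENNReal.ofReal (m.dist a b) := by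
  obtain ⟨ρ, hρ, -, hm⟩ := h
  refine ⟨fun a => ?_, fun a b => ?_, fun a b c => ?_, fun c a b => ?_, fun a b c => ?_⟩
  · rw [m.dist_self, ENNReal.ofReal_zero]
  · rw [m.dist_comm]
  · exact (ENNReal.ofReal_le_ofReal (m.dist_triangle a b c)).trans ENNReal.ofReal_add_le
  · rw [hm, hm, hρ.dist_mul_left]
  · rw [hm, hm, hρ.dist_mul_right]

theorem closure_eq_top_of_isLeast {m : MetricSpace G} {A : Set G}
    (hA : ∀ a b : G, IsLeast (decompositionSums m.dist A a b) (m.dist a b)) :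
    Subgroup.closure A = ⊤ := by
  refine (Subgroup.eq_top_iff' _).2 fun a => ?_
  obtain ⟨l, hl, rfl, -⟩ := (hA a a).1
  refine Subgroup.list_prod_mem _ fun x hx => ?_
  obtain ⟨p, hp, rfl⟩ := List.mem_map.1 hx
  exact Subgroup.subset_closure (hl p hp).1

end FinitelyGenerated

/-! ### Amalgamation of finitely generated metrics -/

section Amalgam

variable {G₀ G₁ G₂ Γ : Type u} [Group G₀] [Group G₁] [Group G₂] [Group Γ]

/-- The distances of the elements of `A` as prescribed distances of their images. -/
def mapTriples {G : Type v} [Group G] (ψ : G →* Γ) (d : G → G → ℝ) (A : Set G) :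
    Set (Γ × Γ × ℝ) :=
  (fun p : G × G => (ψ p.1, ψ p.2, d p.1 p.2)) '' A ×ˢ A

/-- Prescribed triples in `Γ` are lifted to pairs in the factors, the form in which
`CompatibleEDist.le_sum` applies. -/
theorem exists_sum_list {ψ₁ : G₁ →* Γ} {ψ₂ : G₂ →* Γ} {d₁ : G₁ → G₁ → ℝ} {d₂ : G₂ → G₂ → ℝ}
    {A₁ : Set G₁} {A₂ : Set G₂} (l : List (Γ × Γ × ℝ))
    (hl : ∀ t ∈ l, t ∈ mapTriples ψ₁ d₁ A₁ ∪ mapTriples ψ₂ d₂ A₂) :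
    ∃ l' : List ((G₁ × G₁) ⊕ (G₂ × G₂)),
      l'.map (fun p => (amalgamPair ψ₁ ψ₂ p).1) = l.map (fun t => t.1) ∧
      l'.map (fun p => (amalgamPair ψ₁ ψ₂ p).2) = l.map (fun t => t.2.1) ∧
      l'.map (Sum.elim (Function.uncurry fun a b => ENNReal.ofReal (d₁ a b))
        (Function.uncurry fun a b => ENNReal.ofReal (d₂ a b))) =
        l.map (fun t => ENNReal.ofReal t.2.2) := by
  induction l with
  | nil => exact ⟨[], rfl, rfl, rfl⟩
  | cons t l ih =>
    obtain ⟨l', h1, h2, h3⟩ := ih fun y hy => hl y (List.mem_cons_of_mem _ hy)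
    rcases hl t List.mem_cons_self with ⟨p, -, rfl⟩ | ⟨p, -, rfl⟩
    · exact ⟨Sum.inl p :: l', by rw [List.map_cons, h1]; rfl, by rw [List.map_cons, h2]; rfl,
        by simp [h3, Function.uncurry]⟩
    · exact ⟨Sum.inr p :: l', by rw [List.map_cons, h1]; rfl, by rw [List.map_cons, h2]; rfl,
        by simp [h3, Function.uncurry]⟩

theorem List.sum_map_ofReal {α : Type*} (l : List α) (f : α → ℝ) (hf : ∀ a ∈ l, 0 ≤ f a) :
    (l.map fun a => ENNReal.ofReal (f a)).sum = ENNReal.ofReal (l.map f).sum := by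
  induction l with
  | nil => simp
  | cons a l ih =>
    have hl : ∀ a ∈ l, 0 ≤ f a := fun y hy => hf y (List.mem_cons_of_mem _ hy)
    rw [List.map_cons, List.map_cons, List.sum_cons, List.sum_cons, ih hl,
      ENNReal.ofReal_add (hf a List.mem_cons_self)]
    refine List.sum_nonneg fun x hx => ?_
    obtain ⟨t, ht, rfl⟩ := List.mem_map.1 hx
    exact hl t ht

variable {K : ℚ} {m₁ : MetricSpace G₁} {m₂ : MetricSpace G₂} {j₁ : G₀ →* G₁} {j₂ : G₀ →* G₂}
  {ψ₁ : G₁ →* Γ} {ψ₂ : G₂ →* Γ}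

/-- For `≤`, an optimal decomposition for `ρ₁` maps to one in `Γ` with a sum that is no larger, as
`m₁ ≤ ρ₁`. For `≥`, a decomposition realizing `ρ` lifts to the factors and `CompatibleEDist.le_sum`
bounds its sum below by `m₁`. -/
theorem min_dist_amalgam (h₁ : IsFinitelyGeneratedRationalMetricBoundedBy K m₁)
    (h₂ : IsFinitelyGeneratedRationalMetricBoundedBy K m₂)
    (hj : ∀ h, m₁.dist 1 (j₁ h) = m₂.dist 1 (j₂ h)) (hψ : ExtendsAmalgam j₁ j₂ ψ₁ ψ₂)
    {ρ₁ : MetricSpace G₁} (hm : ∀ a b, m₁.dist a b = min (K : ℝ) (ρ₁.dist a b))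
    {A₁ : Set G₁} (hA₁ : ∀ a b, IsLeast (decompositionSums ρ₁.dist A₁ a b) (ρ₁.dist a b))
    {A₂ : Set G₂} {ρ : MetricSpace Γ}
    (hρ : ∀ a b, IsLeast (tripleSums (mapTriples ψ₁ m₁.dist A₁ ∪ mapTriples ψ₂ m₂.dist A₂) a b)
      (ρ.dist a b)) (a b : G₁) :
    min (K : ℝ) (ρ.dist (ψ₁ a) (ψ₁ b)) = m₁.dist a b := by
  have hnn : ∀ a b, 0 ≤ m₁.dist a b := @dist_nonneg _ m₁.toPseudoMetricSpace
  have hnn2 : ∀ a b, 0 ≤ m₂.dist a b := @dist_nonneg _ m₂.toPseudoMetricSpace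
  refine le_antisymm ?_ (le_min ((hm a b).trans_le (min_le_left _ _)) ?_)
  · rw [hm]
    refine le_min (min_le_left _ _) ((min_le_right _ _).trans ?_)
    obtain ⟨l, hl, ha, hb, hs⟩ := (hA₁ a b).1
    rw [hs]
    refine ((hρ _ _).2 ⟨l.map fun p => (ψ₁ p.1, ψ₁ p.2, m₁.dist p.1 p.2), fun t ht => ?_,
      ?_, ?_, rfl⟩).trans ?_
    · obtain ⟨p, hp, rfl⟩ := List.mem_map.1 ht
      exact Or.inl ⟨p, hl p hp, rfl⟩
    · rw [← ha, map_list_prod, List.map_map, List.map_map]; rfl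
    · rw [← hb, map_list_prod, List.map_map, List.map_map]; rfl
    · rw [List.map_map]
      exact List.sum_le_sum fun p _ => (hm p.1 p.2).trans_le (min_le_right _ _)
  · obtain ⟨l, hl, ha, hb, hs⟩ := (hρ (ψ₁ a) (ψ₁ b)).1
    obtain ⟨l', h1, h2, h3⟩ := exists_sum_list l hl
    have hc : CompatibleEDist j₁ j₂ (fun a b => ENNReal.ofReal (m₁.dist a b))
        (fun a b => ENNReal.ofReal (m₂.dist a b)) :=
      ⟨h₁.isBiInvariantEDist, h₂.isBiInvariantEDist, fun h => by rw [hj]⟩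
    have key := hc.le_sum hψ l' (h1 ▸ ha) (h2 ▸ hb)
    rw [h3, List.sum_map_ofReal l _ fun t ht => ?_, ← hs] at key
    · exact (ENNReal.ofReal_le_ofReal_iff (@dist_nonneg _ ρ.toPseudoMetricSpace _ _)).1 key
    · rcases hl t ht with ⟨p, -, rfl⟩ | ⟨p, -, rfl⟩
      exacts [hnn _ _, hnn2 _ _]

/-- The distances of two finite sets of generators, as distance data. -/
theorem isDistanceData_union
    {ρ₁ : MetricSpace G₁} (hm₁ : ∀ a b, m₁.dist a b = min (K : ℝ) (ρ₁.dist a b))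
    {ρ₂ : MetricSpace G₂} (hm₂ : ∀ a b, m₂.dist a b = min (K : ℝ) (ρ₂.dist a b))
    (hq₁ : IsRationalMetric ρ₁) (hq₂ : IsRationalMetric ρ₂)
    {A₁ : Set G₁} (hf₁ : A₁.Finite) (ho₁ : 1 ∈ A₁) (hi₁ : A₁⁻¹ = A₁)
    (hA₁ : Subgroup.closure A₁ = ⊤)
    {A₂ : Set G₂} (hf₂ : A₂.Finite) (ho₂ : 1 ∈ A₂) (hi₂ : A₂⁻¹ = A₂)
    (hA₂ : Subgroup.closure A₂ = ⊤) (hψ : ψ₁.range ⊔ ψ₂.range = ⊤) :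
    IsDistanceData (ψ₁ '' A₁ ∪ ψ₂ '' A₂)
      (mapTriples ψ₁ m₁.dist A₁ ∪ mapTriples ψ₂ m₂.dist A₂) where
  finite := (hf₁.image _).union (hf₂.image _)
  one_mem := Or.inl ⟨1, ho₁, map_one _⟩
  inv_eq := by
    rw [Set.union_inv, ← Set.image_inv, ← Set.image_inv, hi₁, hi₂]
  closure_eq := by
    rw [Subgroup.closure_union, ← MonoidHom.map_closure, ← MonoidHom.map_closure, hA₁, hA₂,
      ← MonoidHom.range_eq_map, ← MonoidHom.range_eq_map, hψ]
  finite_triples := ((hf₁.prod hf₁).image _).union ((hf₂.prod hf₂).image _)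
  mem := by
    rintro t (⟨p, hp, rfl⟩ | ⟨p, hp, rfl⟩)
    · exact ⟨Or.inl ⟨_, hp.1, rfl⟩, Or.inl ⟨_, hp.2, rfl⟩⟩
    · exact ⟨Or.inr ⟨_, hp.1, rfl⟩, Or.inr ⟨_, hp.2, rfl⟩⟩
  nonneg := by
    rintro t (⟨p, hp, rfl⟩ | ⟨p, hp, rfl⟩)
    exacts [@dist_nonneg _ m₁.toPseudoMetricSpace _ _, @dist_nonneg _ m₂.toPseudoMetricSpace _ _]
  rational := by
    rintro t (⟨p, hp, rfl⟩ | ⟨p, hp, rfl⟩)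
    · obtain ⟨q, hq⟩ := hq₁ p.1 p.2
      exact ⟨min K q, by simp only [hm₁, hq]; push_cast; rfl⟩
    · obtain ⟨q, hq⟩ := hq₂ p.1 p.2
      exact ⟨min K q, by simp only [hm₂, hq]; push_cast; rfl⟩
  eq_of_eq_zero := by
    rintro t (⟨p, hp, rfl⟩ | ⟨p, hp, rfl⟩) h
    · exact congrArg ψ₁ (m₁.eq_of_dist_eq_zero h)
    · exact congrArg ψ₂ (m₂.eq_of_dist_eq_zero h)
  symm := by
    rintro t (⟨p, hp, rfl⟩ | ⟨p, hp, rfl⟩)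
    · exact Or.inl ⟨p.swap, ⟨hp.2, hp.1⟩, by simp [m₁.dist_comm p.2 p.1]⟩
    · exact Or.inr ⟨p.swap, ⟨hp.2, hp.1⟩, by simp [m₂.dist_comm p.2 p.1]⟩
  diag := by
    rintro _ (⟨a, ha, rfl⟩ | ⟨a, ha, rfl⟩)
    · exact Or.inl ⟨(a, a), ⟨ha, ha⟩, by simp [m₁.dist_self]⟩
    · exact Or.inr ⟨(a, a), ⟨ha, ha⟩, by simp [m₂.dist_self]⟩
  exists_one := by
    rintro _ (⟨a, ha, rfl⟩ | ⟨a, ha, rfl⟩)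
    · exact ⟨m₁.dist a 1, Or.inl ⟨(a, 1), ⟨ha, ho₁⟩, by simp⟩⟩
    · exact ⟨m₂.dist a 1, Or.inr ⟨(a, 1), ⟨ha, ho₂⟩, by simp⟩⟩

/-- The amalgamation of two finitely generated rational metrics bounded by `K`. -/
theorem exists_amalgam_metric (hK : 0 < K)
    (h₁ : IsFinitelyGeneratedRationalMetricBoundedBy K m₁)
    (h₂ : IsFinitelyGeneratedRationalMetricBoundedBy K m₂)
    (hj : ∀ h, m₁.dist 1 (j₁ h) = m₂.dist 1 (j₂ h)) (hψ : ExtendsAmalgam j₁ j₂ ψ₁ ψ₂)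
    (hr : ψ₁.range ⊔ ψ₂.range = ⊤) :
    ∃ m : MetricSpace Γ, IsFinitelyGeneratedRationalMetricBoundedBy K m ∧
      (∀ a b, m.dist (ψ₁ a) (ψ₁ b) = m₁.dist a b) ∧
      ∀ a b, m.dist (ψ₂ a) (ψ₂ b) = m₂.dist a b := by
  obtain ⟨ρ₁, ⟨A₁, hf₁, ho₁, hi₁, hA₁⟩, hq₁, hm₁⟩ := id h₁
  obtain ⟨ρ₂, ⟨A₂, hf₂, ho₂, hi₂, hA₂⟩, hq₂, hm₂⟩ := id h₂
  obtain ⟨ρ, hρ, hq, hl⟩ := (isDistanceData_union hm₁ hm₂ hq₁ hq₂ hf₁ ho₁ hi₁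
    (closure_eq_top_of_isLeast hA₁) hf₂ ho₂ hi₂ (closure_eq_top_of_isLeast hA₂) hr).exists_metric
  refine ⟨ρ.minConst (K := K) (by exact_mod_cast hK), ⟨ρ, hρ, hq, fun _ _ => rfl⟩,
    min_dist_amalgam h₁ h₂ hj hψ hm₁ hA₁ hl,
    min_dist_amalgam (A₂ := A₁) h₂ h₁ (fun h => (hj h).symm) hψ.symm hm₂ hA₂ ?_⟩
  simpa only [Set.union_comm] using hl

end Amalgam

theorem tripleSums_mapTriples {G : Type v} {Γ : Type u} [Group G] [Group Γ] (ψ : G →* Γ)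
    (hψ : Function.Injective ψ) (d : G → G → ℝ) (A : Set G) (a b : G) :
    tripleSums (mapTriples ψ d A) (ψ a) (ψ b) = decompositionSums d A a b := by
  ext s
  constructor
  · rintro ⟨l, hl, ha, hb, rfl⟩
    have key : ∃ l' : List (G × G), (∀ p ∈ l', p.1 ∈ A ∧ p.2 ∈ A) ∧
        l = l'.map fun p => (ψ p.1, ψ p.2, d p.1 p.2) := by
      clear ha hb
      induction l with
      | nil => exact ⟨[], by simp, rfl⟩
      | cons t l ih =>
        obtain ⟨l', hl', rfl⟩ := ih fun y hy => hl y (List.mem_cons_of_mem _ hy)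
        obtain ⟨p, hp, rfl⟩ := hl t List.mem_cons_self
        exact ⟨p :: l', List.forall_mem_cons.2 ⟨hp, hl'⟩, rfl⟩
    obtain ⟨l', hl', rfl⟩ := key
    refine ⟨l', hl', hψ ?_, hψ ?_, ?_⟩
    · rw [← ha, map_list_prod, List.map_map, List.map_map]; rfl
    · rw [← hb, map_list_prod, List.map_map, List.map_map]; rfl
    · rw [List.map_map]; rfl
  · rintro ⟨l, hl, rfl, rfl, rfl⟩
    refine ⟨l.map fun p => (ψ p.1, ψ p.2, d p.1 p.2), fun t ht => ?_, ?_, ?_, ?_⟩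
    · obtain ⟨p, hp, rfl⟩ := List.mem_map.1 ht
      exact ⟨p, hl p hp, rfl⟩
    · rw [map_list_prod, List.map_map, List.map_map]; rfl
    · rw [map_list_prod, List.map_map, List.map_map]; rfl
    · rw [List.map_map]; rfl

namespace MetricFreeGroup

variable {K : ℚ}

/-! ### Countability -/

/-- Finitely many rational distances in a free group of finite rank. -/
abbrev Code : Type := Σ n : ℕ, Finset (FreeGroup (Fin n) × FreeGroup (Fin n) × ℚ)

/-- The code describes the metric of the object. -/
def Code.Describes (c : Code) (X : MetricFreeGroup.{u} K) : Prop :=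
  ∃ e : X.gens ≃ Fin c.1, ∀ a b, ∃ r : ℝ,
    IsLeast (tripleSums ((fun t : _ × _ × ℚ => (t.1, t.2.1, (t.2.2 : ℝ))) '' (c.2 : Set _))
      (FreeGroup.freeGroupCongr e a) (FreeGroup.freeGroupCongr e b)) r ∧
    X.metric.dist a b = min (K : ℝ) r

/-- The code records the untruncated distances on a finite generating set; the truncation at the
fixed `K` is applied afterwards. -/
theorem exists_code (X : MetricFreeGroup.{u} K) : ∃ c : Code, c.Describes X := by
  obtain ⟨ρ, ⟨A, hA, -, -, hl⟩, hq, hm⟩ := X.metric_spec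
  have := X.finite_gens
  obtain ⟨n, ⟨e⟩⟩ := Finite.exists_equiv_fin X.gens
  choose q hq using hq
  let E := FreeGroup.freeGroupCongr e
  have hfin : ((fun p : FreeGroup X.gens × FreeGroup X.gens => (E p.1, E p.2, q p.1 p.2)) ''
      A ×ˢ A).Finite := (hA.prod hA).image _
  refine ⟨⟨n, hfin.toFinset⟩, e, fun a b => ⟨ρ.dist a b, ?_, hm a b⟩⟩
  rw [Set.Finite.coe_toFinset, Set.image_image]
  simp only [← hq]
  exact (tripleSums_mapTriples E.toMonoidHom E.injective ρ.dist A a b).symm ▸ hl a b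

/-- A bijection of the free generators which preserves the distances is an isomorphism. -/
def isoOfEquiv {X Y : MetricFreeGroup.{u} K} (e : X.gens ≃ Y.gens)
    (he : Isometry (FreeGroup.freeGroupCongr e)) : X ≅ Y where
  hom := ⟨(FreeGroup.freeGroupCongr e).toMonoidHom, he, fun f => ⟨e f, rfl⟩⟩
  inv := ⟨(FreeGroup.freeGroupCongr e).symm.toMonoidHom,
    he.right_inv (FreeGroup.freeGroupCongr e).apply_symm_apply, fun f => ⟨e.symm f, rfl⟩⟩
  hom_inv_id := Hom.ext (MonoidHom.ext (FreeGroup.freeGroupCongr e).symm_apply_apply)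
  inv_hom_id := Hom.ext (MonoidHom.ext (FreeGroup.freeGroupCongr e).apply_symm_apply)

/-- A least element is unique, so the code determines every distance once the generators are
numbered. -/
theorem Code.Describes.iso {c : Code} {X Y : MetricFreeGroup.{u} K} (hX : c.Describes X)
    (hY : c.Describes Y) : Nonempty (X ≅ Y) := by
  obtain ⟨e, he⟩ := hX
  obtain ⟨e', he'⟩ := hY
  refine ⟨isoOfEquiv (e.trans e'.symm) (Isometry.of_dist_eq fun a b => ?_)⟩
  obtain ⟨r, hr, h⟩ := he a b
  obtain ⟨r', hr', h'⟩ := he' (FreeGroup.freeGroupCongr (e.trans e'.symm) a)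
    (FreeGroup.freeGroupCongr (e.trans e'.symm) b)
  have key : ∀ a, FreeGroup.freeGroupCongr e' (FreeGroup.freeGroupCongr (e.trans e'.symm) a) =
      FreeGroup.freeGroupCongr e a := fun a => by
    rw [← MulEquiv.trans_apply, FreeGroup.freeGroupCongr_trans, Equiv.trans_assoc,
      Equiv.symm_trans_self, Equiv.trans_refl]
  rw [key, key] at hr'
  exact h'.trans ((hr'.unique hr ▸ h).symm)

theorem countable_iso_classes :
    Countable (Quotient (isIsomorphicSetoid (MetricFreeGroup.{u} K))) := by
  choose code hcode using exists_code (K := K)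
  refine Function.Injective.countable (f := fun q => code q.out) fun p q h => ?_
  rw [← p.out_eq, ← q.out_eq]
  exact Quotient.sound ((hcode p.out).iso ((show code p.out = code q.out from h) ▸ hcode q.out))

/-! ### Amalgamation -/

theorem Hom.injective {X Y : MetricFreeGroup.{u} K} (φ : X ⟶ Y) :
    Function.Injective φ.toMonoidHom :=
  φ.isometry.injective

theorem Hom.exists_map_eq {X Y : MetricFreeGroup.{u} K} (φ : X ⟶ Y) :
    ∃ p : X.gens → Y.gens, Function.Injective p ∧
      ∀ f, φ.toMonoidHom (FreeGroup.of f) = FreeGroup.of (p f) := by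
  choose p hp using φ.map_gen
  refine ⟨p, fun f g h => ?_, hp⟩
  apply FreeGroup.of_injective
  apply Hom.injective φ
  rw [hp, hp, h]

theorem exists_isFreeAmalgam (hK : 0 < K) {X Y₁ Y₂ : MetricFreeGroup.{u} K} (φ₁ : X ⟶ Y₁)
    (φ₂ : X ⟶ Y₂) : ∃ (Z : MetricFreeGroup.{u} K) (ψ₁ : Y₁ ⟶ Z) (ψ₂ : Y₂ ⟶ Z),
      IsFreeAmalgam φ₁ φ₂ ψ₁ ψ₂ := by
  classical
  obtain ⟨p₁, hi₁, hp₁⟩ := Hom.exists_map_eq φ₁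
  obtain ⟨p₂, hi₂, hp₂⟩ := Hom.exists_map_eq φ₂
  -- The pushout of the generating sets: a generator of `Y₂` coming from `X` is redirected by `q` to
  -- its partner in `Y₁`, and injectivity of `p₂` makes the partner unique.
  let F : Type u := Y₁.gens ⊕ {f : Y₂.gens // f ∉ Set.range p₂}
  let q : Y₂.gens → F := fun f =>
    if h : f ∈ Set.range p₂ then Sum.inl (p₁ h.choose) else Sum.inr ⟨f, h⟩
  have hq : ∀ e, q (p₂ e) = Sum.inl (p₁ e) := fun e => by
    have h : p₂ e ∈ Set.range p₂ := ⟨e, rfl⟩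
    simp only [q, dif_pos h]
    rw [hi₂ h.choose_spec]
  have hq' : ∀ f : {f : Y₂.gens // f ∉ Set.range p₂}, q f = Sum.inr f := fun f =>
    dif_neg f.2
  let ψ₁ : FreeGroup Y₁.gens →* FreeGroup F := FreeGroup.map Sum.inl
  let ψ₂ : FreeGroup Y₂.gens →* FreeGroup F := FreeGroup.map q
  have hψ : ExtendsAmalgam φ₁.toMonoidHom φ₂.toMonoidHom ψ₁ ψ₂ := by
    intro P _ f₁ f₂ hf
    refine ⟨FreeGroup.lift (Sum.elim (fun a => f₁ (FreeGroup.of a))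
      fun b => f₂ (FreeGroup.of b.1)), ?_, ?_⟩
    · ext a
      simp [ψ₁]
    · ext b
      by_cases hb : b ∈ Set.range p₂
      · obtain ⟨e, rfl⟩ := hb
        have := DFunLike.congr_fun hf (FreeGroup.of e)
        simp only [MonoidHom.comp_apply, hp₁, hp₂] at this
        simp [ψ₂, hq, this]
      · simp [ψ₂, hq' ⟨b, hb⟩]
  have hr : ψ₁.range ⊔ ψ₂.range = ⊤ := by
    rw [eq_top_iff, ← FreeGroup.closure_range_of, Subgroup.closure_le]
    rintro _ ⟨f | f, rfl⟩
    · exact Subgroup.mem_sup_left ⟨FreeGroup.of f, by simp [ψ₁]⟩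
    · exact Subgroup.mem_sup_right ⟨FreeGroup.of f.1, by simp [ψ₂, hq']⟩
  have hj : ∀ h, Y₁.metric.dist 1 (φ₁.toMonoidHom h) = Y₂.metric.dist 1 (φ₂.toMonoidHom h) := by
    intro h
    have h₁ := φ₁.isometry.dist_eq 1 h
    have h₂ := φ₂.isometry.dist_eq 1 h
    rw [map_one] at h₁ h₂
    exact h₁.trans h₂.symm
  obtain ⟨m, hm, hm₁, hm₂⟩ := exists_amalgam_metric hK Y₁.metric_spec Y₂.metric_spec hj hψ hr
  have := Y₁.finite_gens
  have := Y₂.finite_gens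
  refine ⟨⟨F, inferInstance, m, hm⟩, ⟨ψ₁, Isometry.of_dist_eq hm₁, fun f => ⟨Sum.inl f, ?_⟩⟩,
    ⟨ψ₂, Isometry.of_dist_eq hm₂, fun f => ⟨q f, ?_⟩⟩, ?_, ?_, ?_⟩
  · simp [ψ₁]
  · simp [ψ₂]
  · refine Hom.ext (FreeGroup.ext_hom _ _ fun e => ?_)
    change ψ₁ (φ₁.toMonoidHom (FreeGroup.of e)) = ψ₂ (φ₂.toMonoidHom (FreeGroup.of e))
    simp [ψ₁, ψ₂, hp₁, hp₂, hq]
  · rintro (f | f)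
    · exact Or.inl ⟨f, by simp [ψ₁]⟩
    · exact Or.inr ⟨f.1, by simp [ψ₂, hq']⟩
  · intro f₁ f₂ h
    have h' : (Sum.inl f₁ : F) = q f₂ := FreeGroup.of_injective (by simpa [ψ₁, ψ₂] using h)
    by_cases hf : f₂ ∈ Set.range p₂
    · obtain ⟨e, rfl⟩ := hf
      rw [hq] at h'
      exact ⟨e, by rw [hp₁, Sum.inl_injective h'], hp₂ e⟩
    · rw [hq' ⟨f₂, hf⟩] at h'
      exact absurd h' Sum.inl_ne_inr

/-! ### Joint embedding -/

theorem exists_isEmpty_gens (hK : 0 < K) : ∃ X : MetricFreeGroup.{u} K, IsEmpty X.gens := by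
  let ρ : MetricSpace (FreeGroup PEmpty.{u + 1}) :=
    { dist := fun _ _ => 0
      dist_self := fun _ => rfl
      dist_comm := fun _ _ => rfl
      dist_triangle := fun _ _ _ => by simp
      eq_of_dist_eq_zero := fun {a b} _ => Subsingleton.elim a b }
  have hρ : IsFinitelyGeneratedMetric ρ := by
    -- The group is trivial, so the empty list decomposes every pair.
    refine ⟨Set.univ, Set.toFinite _, trivial, Set.inv_univ, fun a b =>
      ⟨⟨[], by simp, Subsingleton.elim _ _, Subsingleton.elim _ _, rfl⟩, ?_⟩⟩
    rintro s ⟨l, -, -, -, rfl⟩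
    exact List.sum_nonneg fun x hx => by
      obtain ⟨p, -, rfl⟩ := List.mem_map.1 hx
      exact le_rfl
  have hq : IsRationalMetric ρ := fun _ _ => ⟨0, Rat.cast_zero.symm⟩
  have hm : ∀ a b, ρ.dist a b = min (K : ℝ) (ρ.dist a b) := fun _ _ =>
    (min_eq_right (Rat.cast_nonneg.2 hK.le)).symm
  exact ⟨⟨PEmpty, inferInstance, ρ, ρ, hρ, hq, hm⟩, (inferInstance : IsEmpty PEmpty)⟩

theorem nonempty_hom_of_isEmpty (X Y : MetricFreeGroup.{u} K) [IsEmpty X.gens] :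
    Nonempty (X ⟶ Y) :=
  ⟨⟨1, isometry_subsingleton, fun f => isEmptyElim f⟩⟩

end MetricFreeGroup

theorem mainTheorem7 (K : ℚ) (hK : 0 < K) :
    IsFraisseClass (MetricFreeGroup.{u} K) ∧
    ∀ (X Y₁ Y₂ : MetricFreeGroup.{u} K) (φ₁ : X ⟶ Y₁) (φ₂ : X ⟶ Y₂),
      ∃ (Z : MetricFreeGroup.{u} K) (ψ₁ : Y₁ ⟶ Z) (ψ₂ : Y₂ ⟶ Z),
        MetricFreeGroup.IsFreeAmalgam φ₁ φ₂ ψ₁ ψ₂ := by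
  refine ⟨⟨MetricFreeGroup.countable_iso_classes, fun X Y => ?_, fun X Y₁ Y₂ φ₁ φ₂ => ?_⟩,
    fun X Y₁ Y₂ φ₁ φ₂ => MetricFreeGroup.exists_isFreeAmalgam hK φ₁ φ₂⟩
  -- The free group on no generators embeds into every object, so joint embedding is amalgamation
  -- over it.
  · obtain ⟨O, hO⟩ := MetricFreeGroup.exists_isEmpty_gens.{u} hK
    obtain ⟨φ₁⟩ := MetricFreeGroup.nonempty_hom_of_isEmpty O X
    obtain ⟨φ₂⟩ := MetricFreeGroup.nonempty_hom_of_isEmpty O Y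
    obtain ⟨Z, ψ₁, ψ₂, -⟩ := MetricFreeGroup.exists_isFreeAmalgam hK φ₁ φ₂
    exact ⟨Z, ⟨ψ₁⟩, ⟨ψ₂⟩⟩
  · obtain ⟨Z, ψ₁, ψ₂, h⟩ := MetricFreeGroup.exists_isFreeAmalgam hK φ₁ φ₂
    exact ⟨Z, ψ₁, ψ₂, h.comm⟩
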